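/- A \emph{bidirected graph} $B$ is a finite loopless multigraph with vertex set $V(B)$ and edge set $E(B)$ together with a sign $\sigma(e,u)\in\{+,-\}$ for every edge $e$ and endpoint $u$ of $e$. A \emph{trail} from $v_0$ to $v_\ell$ is a sequence $v_0\vec e_1v_1\vec e_2\dots\vec e_\ell v_\ell$ $(\ell\ge 0)$ in which $\vec e_i$ is an orientation of an edge $e_i$ with tail $v_{i-1}$ and head $v_i$, the edges $e_1,\dots,e_\ell$ are pairwise distinct, and $\sigma(e_{i+1},v_i)=-\sigma(e_i,v_i)$ for $1\le i<\ell$. A \emph{path} is a trail that does not repeat vertices. Trails are \emph{edge-disjoint} if no edge lies on two of them. Fix a root $r\in V(B)$. An $r$\emph{-trail} is a trail that starts in $r$ and has no internal vertex equal to $r$ (it may end in $r$). An edge $e$ is \emph{trail-undirectable} if each of its two orientations is the last oriented edge of some $r$-trail. The rooted bidirected graph $B$ is \emph{edge-clean} if $r$ lies in no nontrivial component of the subgraph formed by the trail-undirectable edges, i.e. if $r$ is not an endpoint of a trail-undirectable edge. For $X\subseteq V(B)\setminus\{r\}$ let $\delta^{\mathsf{path}}_{r,B}(X)$ be the set of edges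 $e$ that have an orientation $\vec e$ with head in $X$ and tail not in $X$ such that some path starting in $r$ has $\vec e$ as its last oriented edge. \textbf{Theorem.} Let $B$ be an edge-clean bidirected graph rooted at $r$ and let $x\in V(B)\setminus\{r\}$. Then the maximum number $\lambda_B^{\mathrm{path}}(r,x)$ of pairwise edge-disjoint $r$--$x$ paths in $B$ satisfies \[\lambda_B^{\mathrm{path}}(r,x)=\min\left\{\left|\delta^{\mathsf{path}}_{r,B}(X)\right| : x\in X\subseteq V(B)\setminus\{r\}\right\}.\] Moreover, the maximum number of pairwise edge-disjoint $r$--$x$ paths (respectively, $r$--$x$ trails) in $B$ equals the minimum size of an edge set $F\subseteq E(B)$ such that $B-F$ contains no $r$--$x$ path (respectively, no $r$--$x$ trail). -/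

import Mathlib

universe u v

/-- A bidirected graph with vertex set `V` and edge set `E`: a loopless multigraph in which every
half-edge `(e, u)` (with `u` an endpoint of `e`) carries a sign `+1` or `-1`.
The value `sign e u` is only ever used when `u` is an endpoint of `e`. -/
structure BidirectedGraph (V : Type u) (E : Type v) where
  /-- the pair of endpoints of an edge -/
  ends : E → Sym2 V
  /-- no edge is a loop -/
  loopless : ∀ e, ¬ (ends e).IsDiag
  /-- the signing of the half-edges -/
  sign : E → V → ℤˣ

namespace BidirectedGraph

variable {V : Type u} {E : Type v}

/-- An edge together with one of its two orientations. -/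
structure OrientedEdge (B : BidirectedGraph V E) where
  edge : E
  tail : V
  head : V
  ends_eq : B.ends edge = s(tail, head)

/-- The oriented edges `l` fit together to a walk from `x` to `y`: the first tail is `x`, the last
head is `y`, and each head is the next tail. The empty list is a walk from `x` to `x`. -/
def Joins (B : BidirectedGraph V E) : V → List B.OrientedEdge → V → Prop
  | x, [], y => x = y
  | x, a :: l, y => a.tail = x ∧ Joins B a.head l y

/-- An `x`–`y` trail: no edge is repeated (in either orientation), and at every
internal vertex of the sequence the arriving and the leaving edge have opposite signs. -/
structure Trail (B : BidirectedGraph V E) (x y : V) where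
  steps : List B.OrientedEdge
  joins : B.Joins x steps y
  edges_nodup : (steps.map OrientedEdge.edge).Nodup
  alternating : steps.IsChain
    (fun a b => B.sign b.edge b.tail = - B.sign a.edge a.head)

namespace Trail

variable {B : BidirectedGraph V E} {x y : V}

/-- The set of underlying edges of a trail. -/
def edgeSet (T : B.Trail x y) : Set E := {e | e ∈ T.steps.map OrientedEdge.edge}

/-- The sequence `v₀, v₁, …, v_ℓ` of vertices of a trail. -/
def vertices (T : B.Trail x y) : List V := x :: T.steps.map OrientedEdge.head

/-- A path is a trail that does not repeat vertices. -/
def IsPath (T : B.Trail x y) : Prop := T.vertices.Nodup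

/-- For a trail starting in `x`: no internal vertex `v₁, …, v_{ℓ-1}` equals `x`. With `x = r` the
root, such trails are the `r`-trails; they may end in `r`. -/
def IsRootTrail (T : B.Trail x y) : Prop := x ∉ (T.steps.map OrientedEdge.head).dropLast

/-- The last oriented edge of the trail is `a`. -/
def EndsWith (T : B.Trail x y) (a : B.OrientedEdge) : Prop := T.steps.getLast? = some a

end Trail

variable (B : BidirectedGraph V E) (r : V)

/-- There is an `r`-trail with terminal oriented edge `a`. -/
def TrailReaches (a : B.OrientedEdge) : Prop :=
  ∃ T : B.Trail r a.head, T.IsRootTrail ∧ T.EndsWith a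

/-- There is an `r`-path with terminal oriented edge `a`. -/
def PathReaches (a : B.OrientedEdge) : Prop :=
  ∃ T : B.Trail r a.head, T.IsPath ∧ T.EndsWith a

/-- An edge is trail-undirectable if both its orientations are terminal edges of `r`-trails. -/
def TrailUndirectable (e : E) : Prop :=
  ∀ a : B.OrientedEdge, a.edge = e → B.TrailReaches r a

/-- `B` rooted at `r` is edge-clean if `r` lies in no trail-undirectable component, that is, in no
nontrivial component of the subgraph formed by the trail-undirectable edges; the vertices of these
components are exactly the endpoints of trail-undirectable edges. -/
def EdgeClean : Prop := ∀ e, B.TrailUndirectable r e → r ∉ B.ends e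

/-- `δ^path_{r,B}(X)`: the edges with an orientation that enters `X` and is the terminal edge of an
`r`-path. -/
def pathCut (X : Set V) : Set E :=
  {e | ∃ a : B.OrientedEdge, a.edge = e ∧ a.head ∈ X ∧ a.tail ∉ X ∧ B.PathReaches r a}

/-- The sizes of the finite families of pairwise edge-disjoint `r`–`x` trails. -/
def trailPackingSizes (x : V) : Set ℕ :=
  {k | ∃ P : Finset (B.Trail r x),
    (P : Set (B.Trail r x)).Pairwise (fun S T => Disjoint S.edgeSet T.edgeSet) ∧ P.card = k}

/-- The sizes of the finite families of pairwise edge-disjoint `r`–`x` paths. -/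
def pathPackingSizes (x : V) : Set ℕ :=
  {k | ∃ P : Finset (B.Trail r x), (∀ T ∈ P, T.IsPath) ∧
    (P : Set (B.Trail r x)).Pairwise (fun S T => Disjoint S.edgeSet T.edgeSet) ∧ P.card = k}

/-- The bidirected graph `B - F`. -/
def deleteEdges (F : Set E) : BidirectedGraph V {e : E // e ∉ F} where
  ends e := B.ends e
  loopless e := B.loopless e
  sign e := B.sign e

end BidirectedGraph

/-! The proof reduces the statement to the edge version of Menger's theorem in a digraph.
Edge-cleanness means that no nontrivial trail from `r` comes back to `r` (`EdgeClean.noReturn`).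
Call an edge bireached if trails from `r` reach both its orientations, and contract the components
formed by these edges; the nontrivial ones are the blossoms. Every other reached edge has one
direction only, so the contraction is a digraph.

Two facts make this digraph faithful. A blossom has at most one entrance, and every trail from `r`
into the blossom passes through it (`mem_of_trail_to_blossom`, `entrance_unique`). At a vertex
outside the blossoms all reached edges arrive with the same sign (`headSign_eq_of_not_inBlossom`).
Hence a directed path of the digraph lifts to an alternating trail or path (`exists_lift`): signs
match automatically outside blossoms, and inside a blossom a segment of a known route is used.
Arc-disjoint directed paths visit disjoint sets of blossoms, since sharing a blossom would mean
sharing its entrance, so their lifts are edge-disjoint.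

Menger's theorem (`exists_disjoint_walks_and_cut`) then gives a packing and a cut of equal size, and
the cut pulls back to a route cut that is no larger. Route cuts block all routes, so weak duality
yields all the equalities. Trails and paths are handled together by a proposition `m` that switches
vertex-simplicity on. In both cases blossoms are defined by trails; only the arcs kept in the
digraph depend on `m`. -/

/-! ### Directed walks -/

/-- The edges of the list `l`, with tails `tl` and heads `hd`, form a directed walk from `x`
to `y`. -/
def IsDiwalk {D : Type*} {W : Type*} (tl hd : D → W) : W → List D → W → Prop
  | x, [], y => x = y
  | x, a :: l, y => tl a = x ∧ IsDiwalk tl hd (hd a) l y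

namespace IsDiwalk

variable {D : Type*} {W : Type*} {tl hd : D → W}

theorem append_iff {x y : W} {l₁ l₂ : List D} :
    IsDiwalk tl hd x (l₁ ++ l₂) y ↔ ∃ z, IsDiwalk tl hd x l₁ z ∧ IsDiwalk tl hd z l₂ y := by
  induction l₁ generalizing x with
  | nil => simp [IsDiwalk]
  | cons a l ih => simp [IsDiwalk, ih, and_assoc]

theorem concat_iff {x y : W} {l : List D} {a : D} :
    IsDiwalk tl hd x (l ++ [a]) y ↔ IsDiwalk tl hd x l (tl a) ∧ hd a = y := by
  rw [append_iff]
  constructor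
  · rintro ⟨z, h, rfl, h'⟩
    exact ⟨h, h'⟩
  · rintro ⟨h, h'⟩
    exact ⟨_, h, rfl, h'⟩

theorem split_iff {x y : W} {l₁ l₂ : List D} {a : D} :
    IsDiwalk tl hd x (l₁ ++ a :: l₂) y ↔
      IsDiwalk tl hd x l₁ (tl a) ∧ IsDiwalk tl hd (hd a) l₂ y := by
  rw [append_iff]
  constructor
  · rintro ⟨z, h, rfl, h'⟩
    exact ⟨h, h'⟩
  · rintro ⟨h, h'⟩
    exact ⟨_, h, rfl, h'⟩

/-- Along a walk the contributions of the internal vertices cancel. -/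
theorem sum_telescope [DecidableEq W] {x y : W} {l : List D} (h : IsDiwalk tl hd x l y) (v : W) :
    (l.map fun d => ((if tl d = v then 1 else 0) - (if hd d = v then 1 else 0) : ℤ)).sum =
      (if x = v then 1 else 0) - (if y = v then 1 else 0) := by
  induction l generalizing x with
  | nil => cases h; simp
  | cons a l ih =>
    obtain ⟨rfl, h⟩ := h
    simp [ih h]

/-- A vertex-simple walk inside `p` to the tail of an edge of `p` yields one to its head. -/
theorem exists_simple_step {p : D → Prop} {s : W} {d : D} (hp : p d)
    (h : ∃ l : List D, (∀ a ∈ l, p a) ∧ IsDiwalk tl hd s l (tl d) ∧ (s :: l.map hd).Nodup) :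
    ∃ l : List D, (∀ a ∈ l, p a) ∧ IsDiwalk tl hd s l (hd d) ∧ (s :: l.map hd).Nodup := by
  obtain ⟨l, hl, hw, hn⟩ := h
  by_cases hd' : hd d ∈ s :: l.map hd
  · rcases List.mem_cons.1 hd' with h | h
    · exact ⟨[], by simp, h.symm, by simp⟩
    · obtain ⟨a, ha, hae⟩ := List.mem_map.1 h
      obtain ⟨l₁, l₂, rfl⟩ := List.append_of_mem ha
      refine ⟨l₁ ++ [a], fun b hb => hl b ?_, ?_, ?_⟩
      · simp at hb ⊢
        tauto
      · exact concat_iff.2 ⟨(split_iff.1 hw).1, hae⟩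
      · refine hn.sublist ?_
        simp
  · refine ⟨l ++ [d], ?_, concat_iff.2 ⟨hw, rfl⟩, ?_⟩
    · intro a ha
      rcases List.mem_append.1 ha with h | h
      · exact hl a h
      · rw [List.mem_singleton.1 h]; exact hp
    · have : s :: (l ++ [d]).map hd = (s :: l.map hd) ++ [hd d] := by simp
      rw [this, List.nodup_append]
      refine ⟨hn, by simp, ?_⟩
      rintro a ha b hb rfl
      rw [List.mem_singleton.1 hb] at ha
      exact hd' ha

end IsDiwalk

/-! ### Integral flows and Menger's theorem for digraphs -/

section Menger

open Finset

variable {D : Type*} {W : Type*} [DecidableEq W] (tl hd : D → W)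

/-- The net outflow at `v` of a set of edges. -/
def netOutflow (J : Finset D) (v : W) : ℤ :=
  ∑ d ∈ J, ((if tl d = v then 1 else 0) - (if hd d = v then 1 else 0))

/-- The edge set `J` is an integral flow of value `k` from `s` to `t`. -/
def IsEdgeFlow (s t : W) (k : ℕ) (J : Finset D) : Prop :=
  ∀ v, netOutflow tl hd J v = k * ((if s = v then 1 else 0) - (if t = v then 1 else 0))

variable {tl hd}

theorem sum_netOutflow (J : Finset D) (R : Finset W) :
    ∑ v ∈ R, netOutflow tl hd J v =
      ∑ d ∈ J, ((if tl d ∈ R then 1 else 0) - (if hd d ∈ R then 1 else 0)) := by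
  unfold netOutflow
  rw [sum_comm]
  refine sum_congr rfl fun d _ => ?_
  rw [sum_sub_distrib, sum_ite_eq, sum_ite_eq]

/-- Summing conservation over a vertex set that separates `s` from `t` cancels everything except the
edges across its boundary. -/
theorem IsEdgeFlow.sum_eq {s t : W} {k : ℕ} {J : Finset D} (h : IsEdgeFlow tl hd s t k J)
    {R : Finset W} (hs : s ∈ R) (ht : t ∉ R) :
    ∑ d ∈ J, ((if tl d ∈ R then 1 else 0) - (if hd d ∈ R then 1 else 0) : ℤ) = k := by
  rw [← sum_netOutflow, sum_congr rfl fun v _ => h v, ← mul_sum, sum_sub_distrib, sum_ite_eq,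
    sum_ite_eq]
  simp [hs, ht]

/-- If the set reachable inside `J` missed `t`, no edge of `J` would leave it, so its net outflow
would be at most zero instead of `k + 1`. -/
theorem IsEdgeFlow.exists_walk [Finite W] {s t : W} {k : ℕ} {J : Finset D}
    (h : IsEdgeFlow tl hd s t (k + 1) J) :
    ∃ l : List D, (∀ a ∈ l, a ∈ J) ∧ IsDiwalk tl hd s l t ∧ (s :: l.map hd).Nodup := by
  classical
  have := Fintype.ofFinite W
  by_contra hcon
  set R : Finset W := univ.filter fun y =>
    ∃ l : List D, (∀ a ∈ l, a ∈ J) ∧ IsDiwalk tl hd s l y ∧ (s :: l.map hd).Nodup with hR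
  have hs : s ∈ R := by
    simp only [hR, mem_filter, mem_univ, true_and]
    exact ⟨[], by simp, rfl, by simp⟩
  have ht : t ∉ R := by simpa [hR] using hcon
  have hsum := h.sum_eq hs ht
  have : ∑ d ∈ J, ((if tl d ∈ R then 1 else 0) - (if hd d ∈ R then 1 else 0) : ℤ) ≤ 0 := by
    refine sum_nonpos fun d hd' => ?_
    have : tl d ∈ R → hd d ∈ R := by
      simp only [hR, mem_filter, mem_univ, true_and]
      exact IsDiwalk.exists_simple_step (p := (· ∈ J)) hd'
    split_ifs with h₁ h₂ h₂
    · norm_num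
    · exact absurd (this h₁) h₂
    · norm_num
    · norm_num
  rw [hsum] at this
  push_cast at this
  linarith

theorem IsDiwalk.sum_toFinset [DecidableEq D] {s t : W} {l : List D}
    (hw : IsDiwalk tl hd s l t) (hn : (s :: l.map hd).Nodup) (v : W) :
    ∑ d ∈ l.toFinset, ((if tl d = v then 1 else 0) - (if hd d = v then 1 else 0) : ℤ) =
      (if s = v then 1 else 0) - (if t = v then 1 else 0) := by
  rw [List.sum_toFinset _ (List.Nodup.of_map _ (List.nodup_cons.1 hn).2)]
  exact hw.sum_telescope v

/-- A flow of value `k` contains `k` edge-disjoint vertex-simple walks. -/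
theorem IsEdgeFlow.exists_walks [Finite W] {s t : W} {k : ℕ} {J : Finset D}
    (h : IsEdgeFlow tl hd s t k J) :
    ∃ f : Fin k → List D,
      (∀ i, (∀ a ∈ f i, a ∈ J) ∧ IsDiwalk tl hd s (f i) t ∧ (s :: (f i).map hd).Nodup) ∧
      ∀ i j, i ≠ j → (f i).Disjoint (f j) := by
  classical
  induction k generalizing J with
  | zero => exact ⟨Fin.elim0, fun i => i.elim0, fun i => i.elim0⟩
  | succ k ih =>
    obtain ⟨l, hl, hw, hn⟩ := h.exists_walk
    have h' : IsEdgeFlow tl hd s t k (J \ l.toFinset) := by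
      intro v
      have h₁ := sum_sdiff (f := fun d =>
        ((if tl d = v then 1 else 0) - (if hd d = v then 1 else 0) : ℤ))
        (show l.toFinset ⊆ J from fun a ha => hl a (List.mem_toFinset.1 ha))
      rw [hw.sum_toFinset hn v] at h₁
      have h₂ := h v
      unfold netOutflow at h₂ ⊢
      rw [h₂] at h₁
      push_cast at h₁
      linarith
    obtain ⟨f, hf, hdis⟩ := ih h'
    have hnew : ∀ i, l.Disjoint (f i) := fun i a ha hb => by
      have := (hf i).1 a hb
      simp [ha] at this
    refine ⟨Fin.cons l f, fun i => ?_, fun i j hij => ?_⟩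
    · refine Fin.cases ⟨hl, hw, hn⟩ (fun i => ?_) i
      exact ⟨fun a ha => (mem_sdiff.1 ((hf i).1 a ha)).1, (hf i).2⟩
    · induction i using Fin.cases with
      | zero =>
        induction j using Fin.cases with
        | zero => exact absurd rfl hij
        | succ j => simpa using hnew j
      | succ i =>
        induction j using Fin.cases with
        | zero => simpa using (hnew i).symm
        | succ j => simpa using hdis i j (fun h => hij (by rw [h]))

/-- Either a flow admits an augmentation, or some cut has the size of its value. -/
theorem IsEdgeFlow.augment_or_cut [Fintype D] [Finite W] {s t : W} {k : ℕ} {J : Finset D}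
    (h : IsEdgeFlow tl hd s t k J) :
    (∃ J', IsEdgeFlow tl hd s t (k + 1) J') ∨
      ∃ X : Set W, t ∈ X ∧ s ∉ X ∧ {d | tl d ∉ X ∧ hd d ∈ X}.ncard = k := by
  classical
  have := Fintype.ofFinite W
  -- The residual graph: edges carrying flow are reversed, the others keep their direction.
  set tl' : D → W := fun d => if d ∈ J then hd d else tl d with htl'
  set hd' : D → W := fun d => if d ∈ J then tl d else hd d with hhd'
  set R : Finset W := univ.filter fun y =>
    ∃ l : List D, (∀ a ∈ l, True) ∧ IsDiwalk tl' hd' s l y ∧ (s :: l.map hd').Nodup with hR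
  have hs : s ∈ R := by
    simp only [hR, mem_filter, mem_univ, true_and]
    exact ⟨[], by simp, rfl, by simp⟩
  have hstep : ∀ d, tl' d ∈ R → hd' d ∈ R := fun d => by
    simp only [hR, mem_filter, mem_univ, true_and]
    exact IsDiwalk.exists_simple_step (p := fun _ => True) trivial
  by_cases ht : t ∈ R
  · left
    simp only [hR, mem_filter, mem_univ, true_and] at ht
    obtain ⟨l, -, hw, hn⟩ := ht
    -- Augmentation: unused edges of the walk are added, used ones are removed. The latter count
    -- with opposite sign in the residual graph, so the two net outflows add.
    refine ⟨symmDiff J l.toFinset, fun v => ?_⟩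
    have h₁ := hw.sum_toFinset hn v
    have h₂ := h v
    unfold netOutflow at h₂ ⊢
    set c : D → ℤ := fun d => (if tl d = v then 1 else 0) - (if hd d = v then 1 else 0) with hc
    have h₃ : ∀ d, ((if tl' d = v then 1 else 0) - (if hd' d = v then 1 else 0) : ℤ) =
        if d ∈ J then - c d else c d := fun d => by
      by_cases hJ : d ∈ J <;> simp [htl', hhd', hJ, hc]
    rw [sum_congr rfl fun d _ => h₃ d, ← sum_filter_add_sum_filter_not _ (· ∈ J)] at h₁
    have h₄ : ∑ d ∈ l.toFinset with d ∈ J, (if d ∈ J then - c d else c d) =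
        - ∑ d ∈ J ∩ l.toFinset, c d := by
      rw [← sum_neg_distrib, filter_mem_eq_inter, inter_comm]
      exact sum_congr rfl fun d hd => by simp [(mem_inter.1 hd).1]
    have h₅ : ∑ d ∈ l.toFinset with d ∉ J, (if d ∈ J then - c d else c d) =
        ∑ d ∈ l.toFinset \ J, c d := by
      rw [← sdiff_eq_filter]
      exact sum_congr rfl fun d hd => by simp [(mem_sdiff.1 hd).2]
    have h₆ : ∑ d ∈ J ∩ l.toFinset, c d + ∑ d ∈ J \ l.toFinset, c d = ∑ d ∈ J, c d :=
      sum_inter_add_sum_sdiff _ _ _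
    have h₇ : ∑ d ∈ symmDiff J l.toFinset, c d =
        ∑ d ∈ J \ l.toFinset, c d + ∑ d ∈ l.toFinset \ J, c d := by
      rw [symmDiff_def]
      exact sum_union disjoint_sdiff_sdiff
    rw [h₄, h₅] at h₁
    rw [h₇]
    push_cast
    linarith
  · right
    -- No residual edge leaves `R`: all edges leaving `R` lie in `J` and no edge of `J` enters it,
    -- so the edges leaving `R` number exactly the flow value.
    refine ⟨{v | v ∉ R}, ht, by simpa using hs, ?_⟩
    have hsum := h.sum_eq hs ht
    have hterm : ∀ d ∈ J, ((if tl d ∈ R then 1 else 0) - (if hd d ∈ R then 1 else 0) : ℤ) =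
        if tl d ∈ R ∧ hd d ∉ R then 1 else 0 := fun d hJ => by
      have := hstep d
      simp only [htl', hhd', hJ, if_true] at this
      by_cases h₂ : hd d ∈ R
      · simp [h₂, this h₂]
      · simp [h₂]
    rw [sum_congr rfl hterm, sum_boole] at hsum
    have : {d | tl d ∉ {v | v ∉ R} ∧ hd d ∈ {v | v ∉ R}} =
        ((J.filter fun d => tl d ∈ R ∧ hd d ∉ R : Finset D) : Set D) := by
      ext d
      simp only [Set.mem_ofPred_eq, not_not, coe_filter, iff_and_self]
      rintro ⟨h₁, h₂⟩
      by_contra hJ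
      have := hstep d
      simp only [htl', hhd', hJ, if_false] at this
      exact h₂ (this h₁)
    rw [this, Set.ncard_coe_finset]
    exact_mod_cast hsum

/-- Menger's theorem for edge-disjoint directed paths in a finite directed multigraph. -/
theorem exists_disjoint_walks_and_cut [Finite D] [Finite W] {s t : W} (hst : s ≠ t) :
    ∃ (k : ℕ) (X : Set W) (f : Fin k → List D), t ∈ X ∧ s ∉ X ∧
      {d | tl d ∉ X ∧ hd d ∈ X}.ncard = k ∧
      (∀ i, IsDiwalk tl hd s (f i) t ∧ (s :: (f i).map hd).Nodup) ∧
      ∀ i j, i ≠ j → (f i).Disjoint (f j) := by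
  classical
  have := Fintype.ofFinite D
  by_contra hcon
  have key : ∀ k : ℕ, ∃ J, IsEdgeFlow tl hd s t k J := by
    intro k
    induction k with
    | zero => exact ⟨∅, fun v => by simp [netOutflow]⟩
    | succ k ih =>
      obtain ⟨J, hJ⟩ := ih
      rcases hJ.augment_or_cut with h | ⟨X, htX, hsX, hX⟩
      · exact h
      · obtain ⟨f, hf, hdis⟩ := hJ.exists_walks
        exact absurd ⟨k, X, f, htX, hsX, hX, fun i => (hf i).2, hdis⟩ hcon
  -- This flow value exceeds the number of edges, which the net outflow of `{s}` cannot do.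
  obtain ⟨J, hJ⟩ := key (Fintype.card D + 1)
  have h := hJ.sum_eq (mem_singleton_self s) (by simpa using hst.symm)
  have h₁ : ∑ d ∈ J, ((if tl d ∈ ({s} : Finset W) then 1 else 0) -
      (if hd d ∈ ({s} : Finset W) then 1 else 0) : ℤ) ≤ ∑ d ∈ J, 1 :=
    sum_le_sum fun d _ => by split_ifs <;> simp
  have h₂ : J.card ≤ Fintype.card D := card_le_univ J
  rw [h] at h₁
  simp at h₁
  omega

end Menger

/-! ### Oriented edges and operations on trails -/

namespace BidirectedGraph

variable {V : Type u} {E : Type v} {B : BidirectedGraph V E}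

namespace OrientedEdge

/-- The same edge with the opposite orientation. -/
def rev (a : B.OrientedEdge) : B.OrientedEdge :=
  ⟨a.edge, a.head, a.tail, by rw [a.ends_eq, Sym2.eq_swap]⟩

@[simp] theorem rev_rev (a : B.OrientedEdge) : a.rev.rev = a := rfl
@[simp] theorem rev_edge (a : B.OrientedEdge) : a.rev.edge = a.edge := rfl
@[simp] theorem rev_head (a : B.OrientedEdge) : a.rev.head = a.tail := rfl
@[simp] theorem rev_tail (a : B.OrientedEdge) : a.rev.tail = a.head := rfl

theorem eq_or_eq_rev {a b : B.OrientedEdge} (h : a.edge = b.edge) : a = b ∨ a = b.rev := by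
  obtain ⟨e, t, d, ha⟩ := a
  obtain ⟨e', t', d', hb⟩ := b
  obtain rfl : e = e' := h
  have := ha.symm.trans hb
  rw [Sym2.eq_iff] at this
  rcases this with ⟨rfl, rfl⟩ | ⟨rfl, rfl⟩
  · exact Or.inl rfl
  · exact Or.inr rfl

/-- The sign of an oriented edge at its head. -/
def headSign (a : B.OrientedEdge) : ℤˣ := B.sign a.edge a.head

/-- The sign of an oriented edge at its tail. -/
def tailSign (a : B.OrientedEdge) : ℤˣ := B.sign a.edge a.tail

@[simp] theorem headSign_rev (a : B.OrientedEdge) : a.rev.headSign = a.tailSign := rfl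
@[simp] theorem tailSign_rev (a : B.OrientedEdge) : a.rev.tailSign = a.headSign := rfl

instance [Finite V] [Finite E] : Finite B.OrientedEdge := by
  refine Finite.of_injective (fun a : B.OrientedEdge => (a.edge, a.tail, a.head)) ?_
  rintro ⟨e, t, d, h⟩ ⟨e', t', d', h'⟩ hab
  simp only [Prod.mk.injEq] at hab
  obtain ⟨rfl, rfl, rfl⟩ := hab
  rfl

end OrientedEdge

open OrientedEdge

theorem units_int_ne_neg (s : ℤˣ) : s ≠ -s := by
  rcases Int.units_eq_one_or s with rfl | rfl <;> decide

theorem units_int_eq_neg_of_ne {s t : ℤˣ} (h : s ≠ t) : s = -t := by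
  rcases Int.units_eq_one_or s with rfl | rfl <;> rcases Int.units_eq_one_or t with rfl | rfl <;>
    simp_all

theorem exists_eq_concat_of_mem_getLast? {α : Type*} {l : List α} {a : α}
    (h : a ∈ l.getLast?) : ∃ l', l = l' ++ [a] :=
  (List.mem_getLast?_eq_getLast h).elim fun hne he =>
    ⟨l.dropLast, by rw [he, List.dropLast_append_getLast]⟩

/-- The list `l` of oriented edges is the sequence of steps of a trail from `x` to `y`. -/
structure IsTrail (B : BidirectedGraph V E) (x : V) (l : List B.OrientedEdge) (y : V) :
    Prop where
  walk : IsDiwalk tail head x l y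
  nodup : (l.map edge).Nodup
  chain : l.IsChain fun a b => b.tailSign = - a.headSign

/-- The reverse of a sequence of oriented edges. -/
def revSteps (l : List B.OrientedEdge) : List B.OrientedEdge := (l.map rev).reverse

@[simp] theorem revSteps_cons (a : B.OrientedEdge) (l : List B.OrientedEdge) :
    revSteps (a :: l) = revSteps l ++ [a.rev] := by simp [revSteps]

@[simp] theorem edges_revSteps (l : List B.OrientedEdge) :
    (revSteps l).map edge = (l.map edge).reverse := by
  simp [revSteps, Function.comp_def]

theorem mem_edges_revSteps {l : List B.OrientedEdge} {e : E} :
    e ∈ (revSteps l).map edge ↔ e ∈ l.map edge := by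
  rw [edges_revSteps, List.mem_reverse]

theorem getLast?_revSteps (l : List B.OrientedEdge) :
    (revSteps l).getLast? = l.head?.map rev := by
  simp [revSteps]

theorem head?_revSteps (l : List B.OrientedEdge) :
    (revSteps l).head? = l.getLast?.map rev := by
  simp [revSteps]

namespace IsTrail

variable {x y z : V} {l l₁ l₂ : List B.OrientedEdge} {a : B.OrientedEdge}

theorem nil (x : V) : B.IsTrail x [] x := ⟨rfl, by simp, by simp⟩

theorem singleton (a : B.OrientedEdge) : B.IsTrail a.tail [a] a.head :=
  ⟨⟨rfl, rfl⟩, by simp, by simp⟩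

theorem reverse (h : B.IsTrail x l y) : B.IsTrail y (revSteps l) x := by
  refine ⟨?_, ?_, ?_⟩
  · have := h.walk
    clear h
    induction l generalizing x with
    | nil => exact this.symm
    | cons a l ih =>
      obtain ⟨rfl, h⟩ := this
      rw [revSteps_cons]
      exact IsDiwalk.concat_iff.2 ⟨ih h, rfl⟩
  · rw [edges_revSteps]
    exact List.nodup_reverse.2 h.nodup
  · unfold revSteps
    rw [List.isChain_reverse, List.isChain_map]
    refine h.chain.imp fun a b hab => ?_
    simp [hab]

theorem take (h : B.IsTrail x (l₁ ++ a :: l₂) y) : B.IsTrail x (l₁ ++ [a]) a.head := by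
  have hsub : (l₁ ++ [a]).IsPrefix (l₁ ++ a :: l₂) := ⟨l₂, by simp⟩
  exact ⟨IsDiwalk.concat_iff.2 ⟨(IsDiwalk.split_iff.1 h.walk).1, rfl⟩,
    h.nodup.sublist (hsub.sublist.map _), h.chain.prefix hsub⟩

theorem init (h : B.IsTrail x (l₁ ++ a :: l₂) y) : B.IsTrail x l₁ a.tail := by
  have hsub : l₁.IsPrefix (l₁ ++ a :: l₂) := ⟨_, rfl⟩
  exact ⟨(IsDiwalk.split_iff.1 h.walk).1,
    h.nodup.sublist (hsub.sublist.map _), h.chain.prefix hsub⟩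

theorem drop (h : B.IsTrail x (l₁ ++ a :: l₂) y) : B.IsTrail a.tail (a :: l₂) y := by
  have hsub : (a :: l₂).IsSuffix (l₁ ++ a :: l₂) := ⟨_, rfl⟩
  exact ⟨⟨rfl, (IsDiwalk.split_iff.1 h.walk).2⟩,
    h.nodup.sublist (hsub.sublist.map _), h.chain.suffix hsub⟩

theorem tail (h : B.IsTrail x (l₁ ++ a :: l₂) y) : B.IsTrail a.head l₂ y := by
  have hsub : l₂.IsSuffix (l₁ ++ a :: l₂) := ⟨l₁ ++ [a], by simp⟩
  exact ⟨(IsDiwalk.split_iff.1 h.walk).2,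
    h.nodup.sublist (hsub.sublist.map _), h.chain.suffix hsub⟩

theorem append (h₁ : B.IsTrail x l₁ y) (h₂ : B.IsTrail y l₂ z)
    (hd : (l₁.map edge).Disjoint (l₂.map edge))
    (hs : ∀ a ∈ l₁.getLast?, ∀ b ∈ l₂.head?, b.tailSign = - a.headSign) :
    B.IsTrail x (l₁ ++ l₂) z := by
  refine ⟨IsDiwalk.append_iff.2 ⟨_, h₁.walk, h₂.walk⟩, ?_, ?_⟩
  · rw [List.map_append, List.nodup_append']
    exact ⟨h₁.nodup, h₂.nodup, hd⟩
  · exact List.isChain_append.2 ⟨h₁.chain, h₂.chain, hs⟩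

theorem concat (h : B.IsTrail x l y) (ha : a.tail = y) (hd : a.edge ∉ l.map edge)
    (hs : ∀ b ∈ l.getLast?, a.tailSign = - b.headSign) :
    B.IsTrail x (l ++ [a]) a.head := by
  subst ha
  refine h.append (singleton a) ?_ ?_
  · rw [List.map_singleton, List.disjoint_singleton]
    exact hd
  · simpa using hs

/-- The two trails overlap in `a`, so the first one already supplies the sign condition before `a`
and the absence of its edge from `l₁`. -/
theorem glue (h₁ : B.IsTrail x (l₁ ++ [a]) y) (h₂ : B.IsTrail a.tail (a :: l₂) z)
    (hd : (l₁.map edge).Disjoint (l₂.map edge)) : B.IsTrail x (l₁ ++ a :: l₂) z := by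
  refine (h₁.init).append h₂ ?_ ?_
  · have := h₁.nodup
    rw [List.map_append, List.nodup_append'] at this
    rw [List.map_cons, List.disjoint_cons_right]
    exact ⟨fun h => this.2.2 h (by simp), hd⟩
  · have := (List.isChain_append.1 h₁.chain).2.2
    simpa using this

theorem head_of_mem_getLast? (h : B.IsTrail x l y) (ha : a ∈ l.getLast?) : a.head = y := by
  obtain ⟨l', rfl⟩ := exists_eq_concat_of_mem_getLast? ha
  exact (IsDiwalk.concat_iff.1 h.walk).2

theorem notMem_left (h : B.IsTrail x (l₁ ++ a :: l₂) y) : a.edge ∉ l₁.map edge := by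
  have := h.nodup
  rw [List.map_append, List.nodup_append'] at this
  exact fun h => this.2.2 h (by simp)

theorem notMem_right (h : B.IsTrail x (l₁ ++ a :: l₂) y) : a.edge ∉ l₂.map edge := by
  have := h.drop.nodup
  rw [List.map_cons] at this
  exact (List.nodup_cons.1 this).1

end IsTrail

theorem getLast?_append_cons' {α : Type*} (l l' : List α) (a : α) :
    (l ++ a :: l').getLast? = (a :: l').getLast? :=
  List.getLast?_append_of_ne_nil _ (by simp)

theorem exists_first_split {α : Type*} {p : α → Prop} {l : List α} (h : ∃ a ∈ l, p a) :
    ∃ l₁ a l₂, l = l₁ ++ a :: l₂ ∧ p a ∧ ∀ b ∈ l₁, ¬ p b := by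
  induction l with
  | nil => simp at h
  | cons c l ih =>
    by_cases hc : p c
    · exact ⟨[], c, l, rfl, hc, by simp⟩
    · obtain ⟨a, ha, hpa⟩ := h
      rcases List.mem_cons.1 ha with rfl | ha
      · exact absurd hpa hc
      · obtain ⟨l₁, b, l₂, rfl, hb, hl⟩ := ih ⟨a, ha, hpa⟩
        refine ⟨c :: l₁, b, l₂, rfl, hb, fun d hd => ?_⟩
        rcases List.mem_cons.1 hd with rfl | hd
        · exact hc
        · exact hl d hd

/-- If a trail `T` shares an edge with a trail `Q`, then following `T` to the first shared edge
and `Q` from there on yields a trail to one of the two ends of `Q`. -/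
theorem IsTrail.merge {r v w y : V} {T Q : List B.OrientedEdge} (hT : B.IsTrail r T v)
    (hQ : B.IsTrail w Q y) (hTQ : ¬ (T.map edge).Disjoint (Q.map edge)) :
    ∃ P, (∀ e ∈ P.map edge, e ∈ T.map edge ∨ e ∈ Q.map edge) ∧
      ((B.IsTrail r P y ∧ P.getLast? = Q.getLast?) ∨
        (B.IsTrail r P w ∧ P.getLast? = Q.head?.map rev)) := by
  have hex : ∃ a ∈ T, a.edge ∈ Q.map edge := by
    simp only [List.Disjoint, not_forall] at hTQ
    obtain ⟨e, he, he', -⟩ := hTQ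
    obtain ⟨a, ha, rfl⟩ := List.mem_map.1 he
    exact ⟨a, ha, he'⟩
  obtain ⟨T₁, q, T₂, rfl, hq, hT₁⟩ := exists_first_split hex
  -- Stated for arbitrary `Q` so as to apply to the reversed trail as well, in case `T` meets the
  -- shared edge in the other orientation.
  have core : ∀ {w y : V} {Q : List B.OrientedEdge}, B.IsTrail w Q y → q ∈ Q →
      (∀ b ∈ T₁, b.edge ∉ Q.map edge) →
      ∃ P, (∀ e ∈ P.map edge, e ∈ (T₁ ++ q :: T₂).map edge ∨ e ∈ Q.map edge) ∧
        B.IsTrail r P y ∧ P.getLast? = Q.getLast? := by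
    intro w y Q hQ hq hT₁
    obtain ⟨Q₁, Q₂, rfl⟩ := List.append_of_mem hq
    refine ⟨T₁ ++ q :: Q₂, ?_, hT.take.glue hQ.drop ?_, by
      rw [getLast?_append_cons', getLast?_append_cons']⟩
    · intro e he
      simp only [List.map_append, List.map_cons, List.mem_append, List.mem_cons] at he ⊢
      tauto
    · intro e he he'
      obtain ⟨b, hb, rfl⟩ := List.mem_map.1 he
      refine hT₁ b hb ?_
      simp only [List.map_append, List.map_cons, List.mem_append, List.mem_cons]
      tauto
  obtain ⟨q', hq', he⟩ := List.mem_map.1 hq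
  rcases eq_or_eq_rev he with rfl | rfl
  · obtain ⟨P, hP, hP'⟩ := core hQ hq' hT₁
    exact ⟨P, hP, Or.inl hP'⟩
  · obtain ⟨P, hP, hP', hl⟩ := core hQ.reverse
      (by unfold revSteps; rw [List.mem_reverse, List.mem_map]; exact ⟨_, hq', rfl⟩)
      (fun b hb => by rw [mem_edges_revSteps]; exact hT₁ b hb)
    refine ⟨P, fun e he => ?_, Or.inr ⟨hP', by rw [hl, getLast?_revSteps]⟩⟩
    rw [← mem_edges_revSteps (l := Q)]
    exact hP e he

end BidirectedGraph

/-! ### Blossoms and their entrances -/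

namespace BidirectedGraph

open OrientedEdge

variable {V : Type u} {E : Type v} {B : BidirectedGraph V E} {r : V}

/-- Some trail starting in `r` has `a` as its last oriented edge. -/
def Reached (r : V) (a : B.OrientedEdge) : Prop := ∃ l, B.IsTrail r (l ++ [a]) a.head

/-- Both orientations of `a` are reached from `r`. -/
def BiReached (r : V) (a : B.OrientedEdge) : Prop := Reached r a ∧ Reached r a.rev

/-- `v` is incident with an edge both of whose orientations are reached from `r`. -/
def InBlossom (B : BidirectedGraph V E) (r v : V) : Prop :=
  ∃ a : B.OrientedEdge, BiReached r a ∧ a.head = v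

/-- The component of `v` in the graph formed by the edges reached in both orientations. -/
def blossomClass (B : BidirectedGraph V E) (r v : V) :
    Quot fun v w : V => ∃ a : B.OrientedEdge, BiReached r a ∧ a.tail = v ∧ a.head = w :=
  Quot.mk _ v

theorem BiReached.rev {a : B.OrientedEdge} (h : BiReached r a) : BiReached r a.rev := ⟨h.2, h.1⟩

theorem BiReached.of_edge_eq {a b : B.OrientedEdge} (h : BiReached r a) (hab : a.edge = b.edge) :
    BiReached r b := by
  rcases eq_or_eq_rev hab with rfl | rfl
  · exact h
  · exact h.rev

theorem Reached.eq_or_biReached {a b : B.OrientedEdge} (ha : Reached r a) (hb : Reached r b)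
    (hab : a.edge = b.edge) : a = b ∨ BiReached r a := by
  rcases eq_or_eq_rev hab with rfl | rfl
  · exact Or.inl rfl
  · exact Or.inr ⟨ha, hb⟩

theorem IsTrail.reached {l : List B.OrientedEdge} {y : V} {a : B.OrientedEdge}
    (h : B.IsTrail r l y) (ha : a ∈ l) : Reached r a := by
  obtain ⟨l₁, l₂, rfl⟩ := List.append_of_mem ha
  exact ⟨l₁, h.take⟩

theorem BiReached.class_eq {a : B.OrientedEdge} (h : BiReached r a) :
    B.blossomClass r a.tail = B.blossomClass r a.head := Quot.sound ⟨a, h, rfl, rfl⟩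

/-- One direction of transport suffices: bireached edges are closed under reversal, so `P` is
constant along them and descends to the quotient. -/
theorem blossomClass_induction {P : V → Prop}
    (hP : ∀ a : B.OrientedEdge, BiReached r a → P a.tail → P a.head) {v w : V}
    (h : B.blossomClass r v = B.blossomClass r w) (hv : P v) : P w := by
  have key : Quot.lift P (r := fun v w : V =>
        ∃ a : B.OrientedEdge, BiReached r a ∧ a.tail = v ∧ a.head = w) (by
      rintro _ _ ⟨a, ha, rfl, rfl⟩
      exact propext ⟨hP a ha, hP a.rev ha.rev⟩) (B.blossomClass r w) := by
    rw [← h]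
    exact hv
  exact key

theorem InBlossom.of_class_eq {v w : V} (hv : B.InBlossom r v)
    (h : B.blossomClass r v = B.blossomClass r w) : B.InBlossom r w :=
  blossomClass_induction (P := B.InBlossom r) (fun a ha _ => ⟨a, ha, rfl⟩) h hv

theorem eq_of_class_eq {v w : V} (hv : ¬ B.InBlossom r v)
    (h : B.blossomClass r v = B.blossomClass r w) : v = w :=
  blossomClass_induction (P := fun w => v = w)
    (fun a ha hva => absurd ⟨a.rev, ha.rev, hva.symm⟩ hv) h rfl

/-- No nontrivial trail that starts in `r` returns to `r`. -/
def NoReturn (B : BidirectedGraph V E) (r : V) : Prop := ∀ l, B.IsTrail r l r → l = []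

theorem NoReturn.head_ne (hr : B.NoReturn r) {a : B.OrientedEdge} (ha : Reached r a) :
    a.head ≠ r := by
  rintro h
  obtain ⟨l, hl⟩ := ha
  rw [h] at hl
  simpa using hr _ hl

theorem NoReturn.not_inBlossom (hr : B.NoReturn r) : ¬ B.InBlossom r r := by
  rintro ⟨a, ha, h⟩
  exact hr.head_ne ha.1 h

theorem IsTrail.exists_last {l : List B.OrientedEdge} {x y : V} (h : B.IsTrail x l y)
    (hne : x ≠ y) : ∃ l' a, l = l' ++ [a] ∧ a.head = y := by
  rcases List.eq_nil_or_concat' l with rfl | ⟨l', a, rfl⟩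
  · exact absurd h.walk hne
  · exact ⟨l', a, rfl, (IsDiwalk.concat_iff.1 h.walk).2⟩

/-- A vertex of a blossom is reached with both signs. -/
theorem InBlossom.exists_trail_sign (hr : B.NoReturn r) {v : V} (hv : B.InBlossom r v) (s : ℤˣ) :
    ∃ l g, B.IsTrail r (l ++ [g]) v ∧ g.headSign = s := by
  obtain ⟨a, ⟨⟨l, hl⟩, ⟨l', hl'⟩⟩, rfl⟩ := hv
  by_cases h : a.headSign = s
  · exact ⟨l, a, hl, h⟩
  -- The trail ending in `a.rev` is at `a.head` just before its last step, and alternation there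
  -- makes it arrive with the sign opposite to that of `a`.
  · obtain ⟨l'', g, rfl, hg⟩ := hl'.init.exists_last (hr.head_ne ⟨l, hl⟩).symm
    refine ⟨l'', g, hl'.init, ?_⟩
    have := (List.isChain_append.1 hl'.chain).2.2 g (by simp) a.rev (by simp)
    rw [tailSign_rev] at this
    rw [this, ← ne_eq] at h
    have h' := units_int_eq_neg_of_ne h
    simpa using h'

/-- Every trail to the head of `h` that could be continued along the reverse of `h` uses `h`. -/
theorem mem_of_headSign_eq_neg {h t : B.OrientedEdge} (hrev : ¬ Reached r h.rev)
    {l : List B.OrientedEdge} (hl : B.IsTrail r l h.head) (ht : t ∈ l.getLast?)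
    (hs : t.headSign = - h.headSign) : h.edge ∈ l.map edge := by
  by_contra hmem
  refine hrev ⟨l, hl.concat (a := h.rev) rfl hmem ?_⟩
  intro b hb
  obtain rfl : t = b := by
    rw [Option.mem_def] at ht hb
    exact Option.some.inj (ht.symm.trans hb)
  simp [hs]

theorem IsTrail.mem_of_edge_mem {h : B.OrientedEdge} (hrev : ¬ Reached r h.rev)
    {l : List B.OrientedEdge} {y : V} (hl : B.IsTrail r l y) (hmem : h.edge ∈ l.map edge) :
    h ∈ l := by
  obtain ⟨a, ha, hae⟩ := List.mem_map.1 hmem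
  rcases eq_or_eq_rev hae with rfl | rfl
  · exact ha
  · exact absurd (hl.reached ha) hrev

/-- Every trail to the head of an entrance `h` of a blossom uses `h`. -/
theorem edge_mem_of_trail_to_head (hr : B.NoReturn r) {h : B.OrientedEdge} (hh : Reached r h)
    (hrev : ¬ Reached r h.rev) (hb : B.InBlossom r h.head) {T : List B.OrientedEdge}
    (hT : B.IsTrail r T h.head) : h.edge ∈ T.map edge := by
  by_contra hmem
  -- This trail must use `h`. What follows `h` on it is a closed trail at `h.head` avoiding `h`,
  -- with sign opposite to `h` at both its ends.
  obtain ⟨l, g, hl, hg⟩ := hb.exists_trail_sign hr (- h.headSign)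
  have hhl := hl.mem_of_edge_mem hrev
    (mem_of_headSign_eq_neg hrev hl (t := g) (by simp) hg)
  obtain ⟨Q₁, Q₂, hQ⟩ := List.append_of_mem hhl
  rw [hQ] at hl
  have hlast : (h :: Q₂).getLast? = some g := by
    rw [← getLast?_append_cons' Q₁, ← hQ]
    simp
  have hQ₂ : Q₂ ≠ [] := by
    rintro rfl
    obtain rfl : h = g := by simpa using hlast
    exact units_int_ne_neg _ hg
  obtain ⟨q, Q₃, rfl⟩ := List.exists_cons_of_ne_nil hQ₂
  have hlast' : (q :: Q₃).getLast? = some g := by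
    rw [← hlast, List.getLast?_cons_cons]
  have hq : q.tailSign = - h.headSign := by
    have := hl.drop.chain
    exact (List.isChain_cons_cons.1 this).1
  have hno : h.edge ∉ (q :: Q₃).map edge := hl.notMem_right
  have hcirc : B.IsTrail h.head (q :: Q₃) h.head := hl.tail
  -- In every case some trail avoids `h` and arrives at `h.head` with the opposite sign, so that
  -- `h.rev` could follow: `T` itself, `T` followed by the closed trail, or a merge of the two
  -- ending in `g` or `q.rev`.
  by_cases hdis : (T.map edge).Disjoint ((q :: Q₃).map edge)
  · obtain ⟨T', t, rfl, ht⟩ := hT.exists_last (hr.head_ne hh).symm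
    by_cases hts : t.headSign = - h.headSign
    · exact hmem (mem_of_headSign_eq_neg hrev hT (by simp) hts)
    · have hts' := units_int_eq_neg_of_ne hts
      have happ := hT.append hcirc hdis (by
        intro a ha b hb
        simp only [List.getLast?_concat, Option.mem_def, Option.some.injEq, List.head?_cons]
          at ha hb
        subst ha hb
        rw [hq, hts']
        simp)
      have := mem_of_headSign_eq_neg hrev happ (t := g)
        (by rw [getLast?_append_cons']; exact hlast') hg
      rw [List.map_append, List.mem_append] at this
      exact this.elim hmem hno
  · obtain ⟨P, hP, ⟨hP', hPl⟩ | ⟨hP', hPl⟩⟩ := hT.merge hcirc hdis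
    · exact (hP _ (mem_of_headSign_eq_neg hrev hP' (t := g) (by rw [hPl]; exact hlast') hg)).elim
        hmem hno
    · exact (hP _ (mem_of_headSign_eq_neg hrev hP' (t := q.rev) (by rw [hPl]; simp) hq)).elim
        hmem hno

/-- The vertices reached only through `h` are closed under passing along edges that are reached in
both orientations. -/
theorem edge_mem_of_biReached (hr : B.NoReturn r) {h f : B.OrientedEdge}
    (hrev : ¬ Reached r h.rev) (hf : BiReached r f)
    (hw : ∀ T, B.IsTrail r T h.head → h.edge ∈ T.map edge)
    (hv : ∀ T, B.IsTrail r T f.tail → h.edge ∈ T.map edge) :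
    ∀ T, B.IsTrail r T f.head → h.edge ∈ T.map edge := by
  have hfh : h.edge ≠ f.edge := fun he => hrev (hf.of_edge_eq he.symm).2
  -- A trail to `f.head` avoiding `h` cannot contain the edge of `f`, as an initial part would reach
  -- `f.tail` without `h`. Were its last sign opposite to that of `f`, appending `f.rev` would reach
  -- `f.tail` without `h`.
  have hsign : ∀ T t, B.IsTrail r (T ++ [t]) f.head → h.edge ∉ (T ++ [t]).map edge →
      t.headSign = f.headSign := by
    intro T t hT hmem
    have hfT : f.edge ∉ (T ++ [t]).map edge := by
      intro hfT
      obtain ⟨a, ha, hae⟩ := List.mem_map.1 hfT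
      obtain ⟨T₁, T₂, hT₁⟩ := List.append_of_mem ha
      rw [hT₁] at hT hmem
      rcases eq_or_eq_rev hae with rfl | rfl
      · have := hv _ hT.init
        simp only [List.map_append, List.mem_append] at hmem
        exact hmem (Or.inl this)
      · have := hv _ hT.take
        simp only [List.map_append, List.mem_append, List.map_cons, List.mem_cons,
          List.map_nil, List.not_mem_nil, or_false] at this hmem
        tauto
    by_contra hne
    have hne' := units_int_eq_neg_of_ne hne
    have := hv _ (hT.concat (a := f.rev) rfl hfT (by
      intro b hb
      simp only [List.getLast?_concat, Option.mem_def, Option.some.injEq] at hb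
      subst hb
      simp [hne']))
    rw [List.map_append, List.mem_append] at this
    exact this.elim hmem (by simpa using hfh)
  intro T hT
  by_contra hmem
  -- A trail ending in `f.rev` reaches `f.tail`, hence uses `h`. Its segment from `h.head` to
  -- `f.head` arrives with the sign opposite to `f`.
  obtain ⟨Q, hQ⟩ := hf.2
  have hhQ : h ∈ Q ++ [f.rev] := hQ.mem_of_edge_mem hrev (hv _ hQ)
  have hhQ' : h ∈ Q := by
    rcases List.mem_append.1 hhQ with hh | hh
    · exact hh
    · exact absurd (congrArg edge (List.mem_singleton.1 hh)) hfh
  obtain ⟨Q₁, Q₂, rfl⟩ := List.append_of_mem hhQ'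
  have hQ' : B.IsTrail r (Q₁ ++ h :: Q₂) f.head := hQ.init
  have htail := hQ'.tail
  have hno := hQ'.notMem_right
  rcases List.eq_nil_or_concat' Q₂ with rfl | ⟨Q₃, q, rfl⟩
  · have he : h.head = f.head := htail.walk
    rw [← he] at hT
    exact hmem (hw T hT)
  have hqs : q.headSign = - f.headSign := by
    have := (List.isChain_append.1 hQ.chain).2.2 q
      (by rw [getLast?_append_cons', ← List.cons_append]; exact List.getLast?_concat) f.rev (by simp)
    rw [tailSign_rev] at this
    rw [this, neg_neg]
  -- If disjoint, `T` followed by the reversed segment reaches `h.head` without `h`. Otherwise a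
  -- merge either reaches `f.head` with the sign excluded by `hsign`, or reaches `h.head` without
  -- `h`.
  by_cases hdis : (T.map edge).Disjoint ((Q₃ ++ [q]).map edge)
  · obtain ⟨T', t, rfl, ht⟩ := hT.exists_last (hr.head_ne hf.1).symm
    have hts := hsign T' t hT hmem
    have happ := hT.append htail.reverse (by
        intro e he he'
        exact hdis he (mem_edges_revSteps.1 he')) (by
        intro a ha b hb
        rw [head?_revSteps] at hb
        simp only [List.getLast?_concat, Option.mem_def, Option.some.injEq,
          Option.map_some] at ha hb
        subst ha hb
        simp [hts, hqs])
    have := hw _ happ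
    rw [List.map_append, List.mem_append] at this
    exact this.elim hmem fun he => hno (mem_edges_revSteps.1 he)
  · obtain ⟨P, hP, ⟨hP', hPl⟩ | ⟨hP', -⟩⟩ := hT.merge htail hdis
    · obtain ⟨P', rfl⟩ := exists_eq_concat_of_mem_getLast? (a := q) (l := P) (by rw [hPl]; simp)
      have := hsign P' q hP' fun he => (hP _ he).elim hmem hno
      rw [hqs] at this
      exact units_int_ne_neg _ this.symm
    · exact (hP _ (hw P hP')).elim hmem hno

/-- Every trail from the root to a blossom uses each of its entrances. -/
theorem mem_of_trail_to_blossom (hr : B.NoReturn r) {h : B.OrientedEdge} (hh : Reached r h)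
    (hrev : ¬ Reached r h.rev) (hb : B.InBlossom r h.head) {v : V}
    (hv : B.blossomClass r h.head = B.blossomClass r v) {T : List B.OrientedEdge}
    (hT : B.IsTrail r T v) : h ∈ T := by
  refine hT.mem_of_edge_mem hrev ?_
  have hw : ∀ T, B.IsTrail r T h.head → h.edge ∈ T.map edge :=
    fun T => edge_mem_of_trail_to_head hr hh hrev hb
  exact blossomClass_induction (P := fun v => ∀ T, B.IsTrail r T v → h.edge ∈ T.map edge)
    (fun f hf => edge_mem_of_biReached hr hrev hf hw) hv hw T hT

/-- A blossom has at most one entrance. -/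
theorem entrance_unique (hr : B.NoReturn r) {h h' : B.OrientedEdge} (hh : Reached r h)
    (hrev : ¬ Reached r h.rev) (hh' : Reached r h') (hrev' : ¬ Reached r h'.rev)
    (hb : B.InBlossom r h.head)
    (hc : B.blossomClass r h.head = B.blossomClass r h'.head) : h = h' := by
  by_contra hne
  obtain ⟨l, hl⟩ := hh
  -- A trail ending in `h` must use `h'` earlier, and its part up to `h'` must in turn use `h`,
  -- which would then be repeated.
  have hmem := mem_of_trail_to_blossom hr hh' hrev' (hb.of_class_eq hc) hc.symm hl
  have hmem' : h' ∈ l := by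
    rcases List.mem_append.1 hmem with h₁ | h₁
    · exact h₁
    · exact absurd (List.mem_singleton.1 h₁).symm hne
  obtain ⟨l₁, l₂, rfl⟩ := List.append_of_mem hmem'
  have h₂ := mem_of_trail_to_blossom hr ⟨_, hl⟩ hrev hb hc hl.init.take
  have h₃ : h ∈ l₁ := by
    rcases List.mem_append.1 h₂ with h₁ | h₁
    · exact h₁
    · exact absurd (List.mem_singleton.1 h₁) hne
  refine hl.notMem_left (List.mem_map_of_mem ?_)
  exact List.mem_append_left _ h₃

/-- The part of a trail after the entrance of the blossom it ends in stays in that blossom. -/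
theorem biReached_after_entrance (hr : B.NoReturn r) {h : B.OrientedEdge}
    (hrev : ¬ Reached r h.rev) (hb : B.InBlossom r h.head) {l₁ l₂ : List B.OrientedEdge} {v : V}
    (hl : B.IsTrail r (l₁ ++ h :: l₂) v)
    (hv : B.blossomClass r h.head = B.blossomClass r v) :
    ∀ a ∈ l₂, BiReached r a ∧ B.blossomClass r a.head = B.blossomClass r h.head := by
  have hh : Reached r h := hl.reached (by simp)
  induction l₂ using List.reverseRecOn generalizing v with
  | nil => simp
  | append_singleton l a ih =>
    have hlast : a.head = v := hl.head_of_mem_getLast? (by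
      rw [getLast?_append_cons', ← List.cons_append]; exact List.getLast?_concat)
    subst hlast
    have ha : Reached r a := hl.reached (by simp)
    -- Otherwise `a` would be a second entrance, hence equal to `h`, which the trail has already
    -- used.
    have hbi : BiReached r a := by
      by_contra hcon
      have := entrance_unique hr hh hrev ha (fun h' => hcon ⟨ha, h'⟩) hb hv
      subst this
      exact hl.notMem_right (by simp)
    have hl' : B.IsTrail r (l₁ ++ h :: l) a.tail := by
      have : l₁ ++ h :: (l ++ [a]) = (l₁ ++ h :: l) ++ a :: [] := by simp
      rw [this] at hl
      exact hl.init
    intro b hb'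
    rcases List.mem_append.1 hb' with hb' | hb'
    · exact ih hl' (hv.trans hbi.class_eq.symm) b hb'
    · rw [List.mem_singleton.1 hb']
      exact ⟨hbi, hv.symm⟩

/-- All oriented edges reaching a vertex outside the blossoms arrive with the same sign. -/
theorem headSign_eq_of_not_inBlossom {a b : B.OrientedEdge} (ha : Reached r a)
    (hb : Reached r b) (hab : a.head = b.head) (hv : ¬ B.InBlossom r a.head) :
    a.headSign = b.headSign := by
  by_contra hne
  have hra : ¬ Reached r a.rev := fun h => hv ⟨a, ⟨ha, h⟩, rfl⟩
  have hrb : ¬ Reached r b.rev := fun h => hv ⟨b, ⟨hb, h⟩, hab.symm⟩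
  obtain ⟨l, hl⟩ := ha
  -- A trail ending in `a` could be continued by `b.rev` unless it used `b`. By symmetry its part up
  -- to `b` uses `a`, which is then repeated.
  have hmem := hl.mem_of_edge_mem hrb (by
    rw [hab] at hl
    exact mem_of_headSign_eq_neg hrb hl (t := a) (by simp) (units_int_eq_neg_of_ne hne))
  have hmem' : b ∈ l := by
    rcases List.mem_append.1 hmem with h₁ | h₁
    · exact h₁
    · exact absurd (congrArg headSign (List.mem_singleton.1 h₁)).symm hne
  obtain ⟨l₁, l₂, rfl⟩ := List.append_of_mem hmem'
  have h₁ := hl.init.take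
  rw [← hab] at h₁
  have h₂ := mem_of_headSign_eq_neg hra h₁ (t := b) (by simp)
    (units_int_eq_neg_of_ne (Ne.symm hne))
  refine hl.notMem_left ?_
  simp only [List.map_append, List.map_cons, List.map_nil, List.mem_append, List.mem_cons,
    List.not_mem_nil, or_false] at h₂ ⊢
  tauto

end BidirectedGraph

/-! ### The digraph of blossoms and the lifting of directed paths -/

theorem IsDiwalk.map_iff {D D' W : Type*} {tl hd : D → W} {g : D' → D} {x y : W} {l : List D'} :
    IsDiwalk tl hd x (l.map g) y ↔ IsDiwalk (tl ∘ g) (hd ∘ g) x l y := by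
  induction l generalizing x with
  | nil => rfl
  | cons a l ih => simp [IsDiwalk, ih]

namespace BidirectedGraph

open OrientedEdge

variable {V : Type u} {E : Type v} {B : BidirectedGraph V E} {r : V} {m : Prop}

/-- The list `l` is the sequence of steps of a trail from `x` to `y`; if `m` holds, then moreover
no vertex is entered twice. This treats trails (`m = False`) and paths (`m = True`) at once. -/
def IsRoute (B : BidirectedGraph V E) (m : Prop) (x : V) (l : List B.OrientedEdge) (y : V) :
    Prop :=
  B.IsTrail x l y ∧ (m → (l.map head).Nodup)

/-- Some route starting in `r` has `a` as its last oriented edge. -/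
def RouteReached (m : Prop) (r : V) (a : B.OrientedEdge) : Prop :=
  ∃ l, B.IsRoute m r (l ++ [a]) a.head

/-- The edges with an orientation that enters `X` and is the last step of a route from `r`. -/
def routeCut (B : BidirectedGraph V E) (m : Prop) (r : V) (X : Set V) : Set E :=
  {e | ∃ a : B.OrientedEdge, a.edge = e ∧ a.head ∈ X ∧ a.tail ∉ X ∧ RouteReached m r a}

namespace IsRoute

variable {x y : V} {l₁ l₂ : List B.OrientedEdge} {a : B.OrientedEdge}

theorem take (h : B.IsRoute m x (l₁ ++ a :: l₂) y) : B.IsRoute m x (l₁ ++ [a]) a.head :=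
  ⟨h.1.take, fun hm => (h.2 hm).sublist (by simp)⟩

theorem init (h : B.IsRoute m x (l₁ ++ a :: l₂) y) : B.IsRoute m x l₁ a.tail :=
  ⟨h.1.init, fun hm => (h.2 hm).sublist (by simp)⟩

end IsRoute

theorem RouteReached.reached {a : B.OrientedEdge} (h : RouteReached m r a) : Reached r a :=
  h.imp fun _ hl => hl.1

/-- A directed path in the graph of blossoms can be realised by a route that reaches its end with
the same sign as a given route and that only uses edges of the path and of the blossoms it
visits. -/
theorem exists_lift (hr : B.NoReturn r) {l : List B.OrientedEdge}
    (hl : ∀ d ∈ l, RouteReached m r d ∧ ¬ BiReached r d) {K : List B.OrientedEdge} {v : V}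
    (hw : IsDiwalk (B.blossomClass r ∘ tail) (B.blossomClass r ∘ head) (B.blossomClass r r) l
      (B.blossomClass r v))
    (hn : (B.blossomClass r r :: l.map (B.blossomClass r ∘ head)).Nodup)
    (hK : B.IsRoute m r K v) :
    ∃ L, B.IsRoute m r L v ∧ L.getLast?.map headSign = K.getLast?.map headSign ∧
      ∀ a ∈ L, a ∈ l ∨
        (BiReached r a ∧ ∃ d ∈ l, B.blossomClass r d.head = B.blossomClass r a.head) := by
  induction l using List.reverseRecOn generalizing K v with
  | nil =>
    obtain rfl : r = v := eq_of_class_eq hr.not_inBlossom hw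
    exact ⟨K, hK, rfl, by simp [hr _ hK.1]⟩
  | append_singleton l d ih =>
    obtain ⟨hw', hdv⟩ := IsDiwalk.concat_iff.1 hw
    simp only [Function.comp_apply] at hdv hw'
    obtain ⟨hdm, hdU⟩ := hl d (by simp)
    have hd := hdm.reached
    have hdrev : ¬ Reached r d.rev := fun h => hdU ⟨hd, h⟩
    have hn' : (B.blossomClass r r :: l.map (B.blossomClass r ∘ head)).Nodup :=
      hn.sublist (by simp)
    have hdnew : ∀ a ∈ l, B.blossomClass r a.head ≠ B.blossomClass r d.head := by
      intro a ha he
      have := (List.nodup_cons.1 hn).2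
      rw [List.map_append, List.nodup_append'] at this
      exact this.2.2 (List.mem_map_of_mem ha) (by simp [he])
    -- The part of the route before `d` is replaced by the lift of the shorter walk. That lift
    -- enters only classes other than that of `d.head`, so nothing is repeated, and it keeps the
    -- final sign of `K₁`, so `d` may follow.
    have core : ∀ {K₁ K₂ : List B.OrientedEdge}, B.IsRoute m r (K₁ ++ d :: K₂) v →
        (∀ a ∈ K₂, BiReached r a ∧ B.blossomClass r a.head = B.blossomClass r d.head) →
        ∃ L, B.IsRoute m r L v ∧ L.getLast? = (d :: K₂).getLast? ∧
          ∀ a ∈ L, a ∈ l ++ [d] ∨ (BiReached r a ∧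
            ∃ d' ∈ l ++ [d], B.blossomClass r d'.head = B.blossomClass r a.head) := by
      intro K₁ K₂ hK hK₂
      obtain ⟨L, hL, hLs, hLc⟩ := ih (fun a ha => hl a (by simp [ha])) hw' hn' hK.init
      have hout : ∀ a ∈ L, B.blossomClass r a.head ≠ B.blossomClass r d.head := by
        intro a ha
        rcases hLc a ha with h | ⟨-, d', hd', he⟩
        · exact hdnew a h
        · rw [← he]
          exact hdnew d' hd'
      have hdL : d.edge ∉ L.map edge := by
        intro hmem
        obtain ⟨a, ha, hae⟩ := List.mem_map.1 hmem
        rcases hd.eq_or_biReached (hL.1.reached ha) hae.symm with rfl | h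
        · exact hout _ ha rfl
        · exact hdU h
      have hLd : B.IsTrail r (L ++ [d]) d.head := by
        refine hL.1.concat rfl hdL fun b hb => ?_
        rw [Option.mem_def] at hb
        rw [hb, Option.map_some, eq_comm, Option.map_eq_some_iff] at hLs
        obtain ⟨b', hb', hbs⟩ := hLs
        rw [← hbs]
        exact (List.isChain_append.1 hK.1.chain).2.2 b' hb' d (by simp)
      refine ⟨L ++ d :: K₂, ⟨hLd.glue hK.1.drop ?_, fun hm => ?_⟩, getLast?_append_cons' _ _ _, ?_⟩
      · intro e he he'
        obtain ⟨a, ha, rfl⟩ := List.mem_map.1 he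
        obtain ⟨b, hb, hab⟩ := List.mem_map.1 he'
        obtain ⟨hbU, hbc⟩ := hK₂ b hb
        rcases eq_or_eq_rev hab with rfl | rfl
        · exact hout _ ha hbc
        · exact hout _ ha (hbU.class_eq.trans hbc)
      · rw [List.map_append, List.nodup_append']
        refine ⟨hL.2 hm, (hK.2 hm).sublist (by simp), ?_⟩
        intro w hw hw'
        obtain ⟨a, ha, rfl⟩ := List.mem_map.1 hw
        obtain ⟨b, hb, hab⟩ := List.mem_map.1 hw'
        refine hout a ha ?_
        rw [← hab]
        rcases List.mem_cons.1 hb with rfl | hb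
        · rfl
        · exact (hK₂ b hb).2
      · intro a ha
        rcases List.mem_append.1 ha with ha | ha
        · rcases hLc a ha with h | ⟨h, d', hd', he⟩
          · exact Or.inl (by simp [h])
          · exact Or.inr ⟨h, d', by simp [hd'], he⟩
        · rcases List.mem_cons.1 ha with rfl | ha
          · exact Or.inl (by simp)
          · exact Or.inr ⟨(hK₂ a ha).1, d, by simp, (hK₂ a ha).2.symm⟩
    -- In a blossom, `d` is the entrance, so `K` passes through `d` and stays in the blossom
    -- afterwards. Outside, any route ending in `d` can replace `K`, because the arrival sign is
    -- forced.
    by_cases hv : B.InBlossom r v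
    · have hdb := hv.of_class_eq hdv.symm
      obtain ⟨K₁, K₂, rfl⟩ :=
        List.append_of_mem (mem_of_trail_to_blossom hr hd hdrev hdb hdv hK.1)
      obtain ⟨L, hL, hLs, hLc⟩ := core hK (biReached_after_entrance hr hdrev hdb hK.1 hdv)
      exact ⟨L, hL, by rw [hLs, getLast?_append_cons'], hLc⟩
    · obtain rfl : v = d.head := eq_of_class_eq hv hdv.symm
      obtain ⟨K', hK'⟩ := hdm
      obtain ⟨L, hL, hLs, hLc⟩ := core hK' (by simp)
      obtain ⟨K'', k, rfl, hk⟩ := hK.1.exists_last (hr.head_ne hd).symm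
      refine ⟨L, hL, ?_, hLc⟩
      have := headSign_eq_of_not_inBlossom hd (hK.1.reached (a := k) (by simp)) hk.symm hv
      simp [hLs, this]

/-- There are edge-disjoint routes from the root to `x` as many as a suitable cut has edges. -/
theorem exists_disjoint_routes_and_cut [Finite V] [Finite E] (hr : B.NoReturn r) {x : V}
    (m : Prop) (hx : x ≠ r) :
    ∃ (k : ℕ) (X : Set V) (f : Fin k → List B.OrientedEdge), x ∈ X ∧ r ∉ X ∧
      (B.routeCut m r X).ncard ≤ k ∧ (∀ i, B.IsRoute m r (f i) x) ∧
      ∀ i j, i ≠ j → ((f i).map edge).Disjoint ((f j).map edge) := by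
  classical
  -- Lifting needs a reference route to `x`. If none exists, the cut at `{x}` is empty; this case is
  -- separate because the class of `x` may be enterable although no route reaches `x` itself.
  by_cases hK : ∃ K, B.IsRoute m r K x
  swap
  · refine ⟨0, {x}, Fin.elim0, rfl, fun h => hx h.symm, ?_, fun i => i.elim0, fun i => i.elim0⟩
    have : B.routeCut m r {x} = ∅ := by
      rw [Set.eq_empty_iff_forall_notMem]
      rintro e ⟨a, -, ha, -, l, hl⟩
      rw [Set.mem_singleton_iff.1 ha] at hl
      exact hK ⟨_, hl⟩
    simp [this]
  obtain ⟨K, hK⟩ := hK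
  let D := {a : B.OrientedEdge // RouteReached m r a ∧ ¬ BiReached r a}
  have hfin : Finite (Quot fun v w : V =>
    ∃ a : B.OrientedEdge, BiReached r a ∧ a.tail = v ∧ a.head = w) := inferInstance
  obtain ⟨k, X, f, hxX, hrX, hcut, hf, hdis⟩ := exists_disjoint_walks_and_cut
    (D := D) (tl := (B.blossomClass r ∘ tail) ∘ Subtype.val)
    (hd := (B.blossomClass r ∘ head) ∘ Subtype.val)
    (s := B.blossomClass r r) (t := B.blossomClass r x)
    (fun h => hx (eq_of_class_eq hr.not_inBlossom h).symm)
  have hlift : ∀ i, ∃ L, B.IsRoute m r L x ∧ ∀ a ∈ L, a ∈ (f i).map Subtype.val ∨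
      (BiReached r a ∧
        ∃ d ∈ (f i).map Subtype.val, B.blossomClass r d.head = B.blossomClass r a.head) := by
    intro i
    obtain ⟨L, hL, -, hLc⟩ := exists_lift hr (l := (f i).map Subtype.val) (m := m) (K := K)
      (v := x) (by
        intro d hd
        obtain ⟨d', -, rfl⟩ := List.mem_map.1 hd
        exact d'.2) (IsDiwalk.map_iff.2 (hf i).1) (by
        rw [List.map_map]
        exact (hf i).2) hK
    exact ⟨L, hL, hLc⟩
  choose g hg hgc using hlift
  refine ⟨k, B.blossomClass r ⁻¹' X, g, hxX, hrX, ?_, hg, ?_⟩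
  -- Both ends of a bireached edge lie in one class, so an edge of the pulled-back cut is never
  -- bireached and comes from an arc of the digraph cut.
  · rw [← hcut]
    refine le_trans (Set.ncard_le_ncard (t := (fun d : D => d.1.edge) '' _) ?_ (Set.toFinite _))
      (Set.ncard_image_le (Set.toFinite _))
    rintro e ⟨a, rfl, hh, ht, ha⟩
    refine ⟨⟨a, ha, fun hbi => ht ?_⟩, ⟨ht, hh⟩, rfl⟩
    rw [Set.mem_preimage, hbi.class_eq]
    exact hh
  · intro i j hij e he he'
    obtain ⟨a, ha, rfl⟩ := List.mem_map.1 he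
    obtain ⟨b, hb, hab⟩ := List.mem_map.1 he'
    have key : ∀ d ∈ (f i).map Subtype.val, ∀ d' ∈ (f j).map Subtype.val, d ≠ d' := by
      intro d hd d' hd' hdd
      obtain ⟨c, hc, rfl⟩ := List.mem_map.1 hd
      obtain ⟨c', hc', hcc⟩ := List.mem_map.1 hd'
      obtain rfl : c' = c := Subtype.ext (hcc.trans hdd.symm)
      exact hdis i j hij hc hc'
    have hD : ∀ {i d}, d ∈ (f i).map Subtype.val → RouteReached m r d ∧ ¬ BiReached r d := by
      intro i d hd
      obtain ⟨c, -, rfl⟩ := List.mem_map.1 hd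
      exact c.2
    -- A shared bireached edge puts both lifts in one blossom, whose unique entrance is then an arc
    -- of both directed paths. Any other shared edge is itself a common arc.
    by_cases haU : BiReached r a
    · have hbU := haU.of_edge_eq hab.symm
      obtain ⟨d, hd, hda⟩ : ∃ d ∈ (f i).map Subtype.val,
          B.blossomClass r d.head = B.blossomClass r a.head :=
        (hgc i a ha).elim (fun h => absurd haU (hD h).2) fun h => h.2
      obtain ⟨d', hd', hdb⟩ : ∃ d ∈ (f j).map Subtype.val,
          B.blossomClass r d.head = B.blossomClass r b.head :=
        (hgc j b hb).elim (fun h => absurd hbU (hD h).2) fun h => h.2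
      have hc : B.blossomClass r a.head = B.blossomClass r b.head := by
        rcases eq_or_eq_rev hab with rfl | rfl
        · rfl
        · exact haU.class_eq.symm
      obtain ⟨h₁, h₂⟩ := hD hd
      obtain ⟨h₃, h₄⟩ := hD hd'
      refine key d hd d' hd' (entrance_unique hr h₁.reached (fun h => h₂ ⟨h₁.reached, h⟩)
        h₃.reached (fun h => h₄ ⟨h₃.reached, h⟩) ?_ (hda.trans (hc.trans hdb.symm)))
      exact InBlossom.of_class_eq ⟨a, haU, rfl⟩ hda.symm
    · have hbU : ¬ BiReached r b := fun h => haU (h.of_edge_eq hab)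
      have h₁ := (hgc i a ha).resolve_right fun h => haU h.1
      have h₂ := (hgc j b hb).resolve_right fun h => hbU h.1
      exact ((hD h₁).1.reached.eq_or_biReached (hD h₂).1.reached hab.symm).elim
        (key a h₁ b h₂) haU

end BidirectedGraph

/-! ### Transfer to trails, paths and edge deletion; the min-max theorem -/

namespace BidirectedGraph

open OrientedEdge

variable {V : Type u} {E : Type v} {B : BidirectedGraph V E} {r : V} {m : Prop}

theorem joins_iff {x y : V} {l : List B.OrientedEdge} :
    B.Joins x l y ↔ IsDiwalk tail head x l y := by
  induction l generalizing x with
  | nil => rfl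
  | cons a l ih => simp [Joins, IsDiwalk, ih]

theorem Trail.isTrail {x y : V} (T : B.Trail x y) : B.IsTrail x T.steps y :=
  ⟨joins_iff.1 T.joins, T.edges_nodup, T.alternating⟩

theorem Trail.isRoute {x y : V} (T : B.Trail x y) (h : m → T.IsPath) :
    B.IsRoute m x T.steps y :=
  ⟨T.isTrail, fun hm => (List.nodup_cons.1 (h hm)).2⟩

/-- The trail with a given sequence of steps. -/
def IsTrail.toTrail {x y : V} {l : List B.OrientedEdge} (h : B.IsTrail x l y) : B.Trail x y :=
  ⟨l, joins_iff.2 h.walk, h.nodup, h.chain⟩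

theorem NoReturn.notMem_heads (hr : B.NoReturn r) {l : List B.OrientedEdge} {y : V}
    (h : B.IsTrail r l y) : r ∉ l.map head := fun hmem => by
  obtain ⟨a, ha, har⟩ := List.mem_map.1 hmem
  exact hr.head_ne (h.reached ha) har

/-- A route only has distinct heads; that the start is not among them comes from `NoReturn`. -/
theorem IsRoute.isPath (hr : B.NoReturn r) {l : List B.OrientedEdge} {y : V}
    (h : B.IsRoute m r l y) (hm : m) : h.1.toTrail.IsPath :=
  List.nodup_cons.2 ⟨hr.notMem_heads h.1, h.2 hm⟩

/-- Up to its first return, such a trail is an `r`-trail ending in an edge at `r`. The reverse of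
that edge is by itself an `r`-trail, so the edge would be trail-undirectable. -/
theorem EdgeClean.noReturn (h : B.EdgeClean r) : B.NoReturn r := by
  intro l hl
  by_contra hne
  have hex : ∃ a ∈ l, a.head = r := by
    rcases List.eq_nil_or_concat' l with rfl | ⟨l', a, rfl⟩
    · exact absurd rfl hne
    · exact ⟨a, by simp, (IsDiwalk.concat_iff.1 hl.walk).2⟩
  obtain ⟨l₁, a, l₂, rfl, ha, hl₁⟩ := exists_first_split hex
  refine h a.edge (fun b hb => ?_) (by rw [a.ends_eq, ha]; exact Sym2.mem_mk_right _ _)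
  rcases eq_or_eq_rev hb with rfl | rfl
  · refine ⟨hl.take.toTrail, ?_, ?_⟩
    · simpa [Trail.IsRootTrail, IsTrail.toTrail] using hl₁
    · simp [Trail.EndsWith, IsTrail.toTrail]
  · have hs := IsTrail.singleton a.rev
    rw [rev_tail, ha] at hs
    refine ⟨hs.toTrail, ?_, ?_⟩
    · simp [Trail.IsRootTrail, IsTrail.toTrail]
    · simp [Trail.EndsWith, IsTrail.toTrail]

theorem pathReaches_iff (hr : B.NoReturn r) {a : B.OrientedEdge} :
    B.PathReaches r a ↔ RouteReached True r a := by
  constructor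
  · rintro ⟨T, hT, ha⟩
    obtain ⟨l, hl⟩ := exists_eq_concat_of_mem_getLast? (Option.mem_def.2 ha)
    have := T.isRoute (m := True) fun _ => hT
    rw [hl] at this
    exact ⟨l, this⟩
  · rintro ⟨l, hl⟩
    exact ⟨hl.1.toTrail, hl.isPath hr trivial, by simp [Trail.EndsWith, IsTrail.toTrail]⟩

theorem pathCut_eq_routeCut (hr : B.NoReturn r) (X : Set V) :
    B.pathCut r X = B.routeCut True r X := by
  ext e
  simp only [pathCut, routeCut, pathReaches_iff hr]

/-- An oriented edge of `B - F` as an oriented edge of `B`. -/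
def OrientedEdge.ofDelete {F : Set E} (a : (B.deleteEdges F).OrientedEdge) : B.OrientedEdge :=
  ⟨a.edge.1, a.tail, a.head, a.ends_eq⟩

theorem isRoute_map_ofDelete {F : Set E} {x y : V} {l : List (B.deleteEdges F).OrientedEdge} :
    B.IsRoute m x (l.map ofDelete) y ↔ (B.deleteEdges F).IsRoute m x l y := by
  have hw : IsDiwalk tail head x (l.map (ofDelete (B := B) (F := F))) y ↔
      IsDiwalk tail head x l y := IsDiwalk.map_iff
  have hn : ((l.map (ofDelete (B := B) (F := F))).map edge).Nodup ↔ (l.map edge).Nodup := by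
    rw [List.map_map, show edge ∘ ofDelete (B := B) (F := F) = Subtype.val ∘ edge from rfl,
      ← List.map_map, List.nodup_map_iff Subtype.val_injective]
  have hc : (l.map (ofDelete (B := B) (F := F))).IsChain (fun a b => b.tailSign = - a.headSign) ↔
      l.IsChain (fun a b => b.tailSign = - a.headSign) := List.isChain_map _
  have hh : (l.map (ofDelete (B := B) (F := F))).map head = l.map head := by
    rw [List.map_map]
    rfl
  unfold IsRoute
  rw [hh]
  exact ⟨fun h => ⟨⟨hw.1 h.1.walk, hn.1 h.1.nodup, hc.1 h.1.chain⟩, h.2⟩,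
    fun h => ⟨⟨hw.2 h.1.walk, hn.2 h.1.nodup, hc.2 h.1.chain⟩, h.2⟩⟩

theorem exists_map_ofDelete {F : Set E} {l : List B.OrientedEdge} (h : ∀ a ∈ l, a.edge ∉ F) :
    ∃ l' : List (B.deleteEdges F).OrientedEdge, l'.map ofDelete = l := by
  have : l ∈ Set.range (List.map (ofDelete (B := B) (F := F))) := by
    rw [Set.range_list_map]
    exact fun a ha => ⟨⟨⟨a.edge, h a ha⟩, a.tail, a.head, a.ends_eq⟩, rfl⟩
  exact this

theorem NoReturn.deleteEdges (hr : B.NoReturn r) (F : Set E) :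
    (B.deleteEdges F).NoReturn r := by
  intro l hl
  have := hr _ (isRoute_map_ofDelete (m := False).2 ⟨hl, False.elim⟩).1
  simpa using this

/-- The edges of a route cut meet every route from the root into the cut off set. -/
theorem routeCut_blocks {x : V} {X : Set V} (hx : x ∈ X) (hrX : r ∉ X) :
    ¬ ∃ T : (B.deleteEdges (B.routeCut m r X)).Trail r x, m → T.IsPath := by
  rintro ⟨T, hT⟩
  have hroute := isRoute_map_ofDelete.2 (T.isRoute hT)
  have hex : ∃ a ∈ T.steps.map ofDelete, a.head ∈ X := by
    obtain ⟨l, a, hl, ha⟩ := hroute.1.exists_last (fun h => hrX (h ▸ hx))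
    exact ⟨a, by rw [hl]; simp, ha ▸ hx⟩
  -- Cut off at its first entry into `X`, the route ends in the entering edge, which therefore
  -- belongs to the deleted cut.
  obtain ⟨l₁, a, l₂, hl, ha, hl₁⟩ := exists_first_split hex
  have hmem : a ∈ T.steps.map ofDelete := by rw [hl]; simp
  rw [hl] at hroute
  have htail : a.tail ∉ X := by
    have h₁ := hroute.init.1
    by_cases he : r = a.tail
    · exact he ▸ hrX
    · obtain ⟨l, b, rfl, hb⟩ := h₁.exists_last he
      rw [← hb]
      exact hl₁ b (by simp)
  obtain ⟨a', -, rfl⟩ := List.mem_map.1 hmem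
  exact a'.edge.2 ⟨_, rfl, ha, htail, l₁, hroute.take⟩

/-- A set of edges meeting all routes has at least as many elements as a packing of routes. -/
theorem card_le_of_blocks [Finite E] (hr : B.NoReturn r) {x : V} {P : Finset (B.Trail r x)}
    (hP : ∀ T ∈ P, m → T.IsPath)
    (hdis : (P : Set (B.Trail r x)).Pairwise fun S T => Disjoint S.edgeSet T.edgeSet) {F : Set E}
    (hF : ¬ ∃ T : (B.deleteEdges F).Trail r x, m → T.IsPath) : P.card ≤ F.ncard := by
  have hex : ∀ T : B.Trail r x, T ∈ P → ∃ e ∈ F, e ∈ T.edgeSet := by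
    intro T hT
    by_contra! hcon
    obtain ⟨l, hl⟩ := exists_map_ofDelete (F := F) (l := T.steps) fun a ha haF =>
      hcon _ haF (List.mem_map_of_mem ha)
    have := T.isRoute (hP T hT)
    rw [← hl] at this
    exact hF ⟨_, (isRoute_map_ofDelete.1 this).isPath (hr.deleteEdges F)⟩
  rcases P.eq_empty_or_nonempty with rfl | ⟨T₀, hT₀⟩
  · simp
  have : Nonempty E := ⟨(hex T₀ hT₀).choose⟩
  choose! g hgF hgT using hex
  rw [← Set.ncard_coe_finset]
  refine Set.ncard_le_ncard_of_injOn g (fun T hT => hgF T hT) ?_ (Set.toFinite F)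
  intro S hS T hT hST
  by_contra hne
  exact Set.disjoint_left.1 (hdis hS hT hne) (hgT S hS) (hST ▸ hgT T hT)

/-- Min-max theorem for edge-disjoint routes. -/
theorem route_menger [Finite V] [Finite E] (hr : B.NoReturn r) {x : V} (hx : x ≠ r) (m : Prop) :
    ∃ k : ℕ,
      IsGreatest {k | ∃ P : Finset (B.Trail r x), (∀ T ∈ P, m → T.IsPath) ∧
        (P : Set (B.Trail r x)).Pairwise (fun S T => Disjoint S.edgeSet T.edgeSet) ∧
        P.card = k} k ∧
      IsLeast {n : ℕ | ∃ X : Set V, x ∈ X ∧ r ∉ X ∧ (B.routeCut m r X).ncard = n} k ∧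
      IsLeast {n : ℕ | ∃ F : Set E,
        (¬ ∃ T : (B.deleteEdges F).Trail r x, m → T.IsPath) ∧ F.ncard = n} k := by
  classical
  obtain ⟨k, X, f, hxX, hrX, hcut, hf, hdis⟩ := exists_disjoint_routes_and_cut hr m hx
  have hdis' : ∀ i j, i ≠ j →
      Disjoint (hf i).1.toTrail.edgeSet (hf j).1.toTrail.edgeSet := fun i j hij =>
    Set.disjoint_left.2 fun e he he' => hdis i j hij he he'
  have hinj : Function.Injective fun i => (hf i).1.toTrail := by
    intro i j hij
    by_contra hne
    obtain ⟨l, a, hl, -⟩ := (hf i).1.exists_last hx.symm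
    have hij' : f i = f j := congrArg Trail.steps hij
    refine hdis i j hne (a := a.edge) ?_ ?_
    · rw [hl]; simp
    · rw [← hij', hl]; simp
  set P : Finset (B.Trail r x) := Finset.univ.image fun i => (hf i).1.toTrail with hPdef
  have hPcard : P.card = k := by
    rw [hPdef, Finset.card_image_of_injective _ hinj, Finset.card_univ, Fintype.card_fin]
  have hPpath : ∀ T ∈ P, m → T.IsPath := by
    intro T hT
    obtain ⟨i, -, rfl⟩ := Finset.mem_image.1 hT
    exact (hf i).isPath hr
  have hPdis : (P : Set (B.Trail r x)).Pairwise fun S T => Disjoint S.edgeSet T.edgeSet := by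
    intro S hS T hT hST
    obtain ⟨i, -, rfl⟩ := Finset.mem_image.1 hS
    obtain ⟨j, -, rfl⟩ := Finset.mem_image.1 hT
    exact hdis' i j fun h => hST (by rw [h])
  have hlow : ∀ F : Set E, (¬ ∃ T : (B.deleteEdges F).Trail r x, m → T.IsPath) → k ≤ F.ncard :=
    fun F hF => hPcard ▸ card_le_of_blocks hr hPpath hPdis hF
  -- The `k` disjoint routes force every blocking set to have at least `k` edges, so the bound
  -- `hcut` is an equality.
  have hX : (B.routeCut m r X).ncard = k := hcut.antisymm (hlow _ (routeCut_blocks hxX hrX))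
  refine ⟨k, ⟨⟨P, hPpath, hPdis, hPcard⟩, ?_⟩, ⟨⟨X, hxX, hrX, hX⟩, ?_⟩,
    ⟨⟨_, routeCut_blocks hxX hrX, hX⟩, ?_⟩⟩
  · rintro n ⟨Q, hQ, hQdis, rfl⟩
    exact (card_le_of_blocks hr hQ hQdis (routeCut_blocks hxX hrX)).trans hcut
  · rintro n ⟨Y, hxY, hrY, rfl⟩
    exact hlow _ (routeCut_blocks hxY hrY)
  · rintro n ⟨F, hF, rfl⟩
    exact hlow F hF

end BidirectedGraph

theorem mainTheorem3 {V : Type u} {E : Type v} [Finite V] [Finite E]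
    (B : BidirectedGraph V E) (r x : V) (hx : x ≠ r) (hclean : B.EdgeClean r) :
    (∃ k : ℕ,
      IsGreatest (B.pathPackingSizes r x) k ∧
      IsLeast {n : ℕ | ∃ X : Set V, x ∈ X ∧ r ∉ X ∧ (B.pathCut r X).ncard = n} k ∧
      IsLeast {n : ℕ | ∃ F : Set E,
        (¬ ∃ T : (B.deleteEdges F).Trail r x, T.IsPath) ∧ F.ncard = n} k) ∧
    (∃ k : ℕ,
      IsGreatest (B.trailPackingSizes r x) k ∧
      IsLeast {n : ℕ | ∃ F : Set E,
        IsEmpty ((B.deleteEdges F).Trail r x) ∧ F.ncard = n} k) := by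
  have hr := hclean.noReturn
  constructor
  · obtain ⟨k, h₁, h₂, h₃⟩ := BidirectedGraph.route_menger hr hx True
    refine ⟨k, ?_, ?_, ?_⟩
    · simpa only [BidirectedGraph.pathPackingSizes, true_imp_iff] using h₁
    · simpa only [BidirectedGraph.pathCut_eq_routeCut hr] using h₂
    · simpa only [true_imp_iff] using h₃
  · obtain ⟨k, h₁, -, h₃⟩ := BidirectedGraph.route_menger hr hx False
    refine ⟨k, ?_, ?_⟩
    · simpa only [BidirectedGraph.trailPackingSizes, false_imp_iff, implies_true, true_and]
        using h₁
    · simpa only [false_imp_iff, exists_const_iff, and_true, not_nonempty_iff] using h₃
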